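/- Let $S$ be a non-empty left cancellative semigroup, not assumed to have an identity. For $p\in S$, $X\subseteq S$ put $pX=\{px: x\in X\}$, $p^{-1}X=\{y\in S: py\in X\}$. Assume that $S$ is right LCM: any $p,q\in S$ with $pS\cap qS\neq\emptyset$ have a right least common multiple, that is, an element $r\in(\{p\}\cup pS)\cap(\{q\}\cup qS)$ with $pS\cap qS=rS$. (If $S$ has an identity, this says just that each $pS\cap qS$ is empty or of the form $rS$.) Let $\mathcal J(S)$ be the smallest family of subsets of $S$ that contains $\emptyset$ and $S$ and is closed under $X\mapsto pX$ and $X\mapsto p^{-1}X$ for all $p\in S$; it is closed under intersections. Let $C^*(S)$ be the universal unital $C^*$-algebra generated by isometries $(v_p)_{p\in S}$ and projections $(e_X)_{X\in\mathcal J(S)}$ such that $v_pv_q=v_{pq}$, $v_pe_Xv_p^*=e_{pX}$, $e_\emptyset=0$, $e_S=1$ and $e_Xe_Y=e_{X\cap Y}$ for all $p,q\in S$, $X,Y\in\mathcal J(S)$. Let $\mathcal D$ be the $C^*$-subalgebra generated by $\{e_X: X\in\mathcal J(S)\}$. Let $\pi:C^*(S)\to B$ be a unital $*$-homomorphism to a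 unital $C^*$-algebra, and let $E_X=\pi(e_X)$. For finite sets $A\subseteq F\subseteq\mathcal J(S)$ put $$Q^E_{F,A}=\prod_{X\in A}E_X\prod_{Y\in F\setminus A}(1-E_Y).$$ Then the following are equivalent: (I) $\pi|_{\mathcal D}:\mathcal D\to\pi(\mathcal D)$ is an isomorphism (equivalently, $\pi$ is injective on $\mathcal D$); (II) $Q^E_{F,A}\neq0$ for all non-empty finite $F\subseteq\mathcal J(S)$ and all non-empty $A\subseteq F$ with $\bigcap_{X\in A}X\cap\bigcap_{Y\in F\setminus A}(S\setminus Y)\neq\emptyset$; (III) $Q^E_{F,\emptyset}=\prod_{X\in F}(1-E_X)\neq0$ for all non-empty finite $F\subseteq\mathcal J(S)\setminus\{S\}$. -/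

import Mathlib

universe u w

open scoped ENNReal

/-! ### Semigroups, constructible right ideals, right LCM semigroups -/

/-- The set `pX = {p x | x ∈ X}`. -/
def leftTranslate {S : Type u} [Mul S] (p : S) (X : Set S) : Set S :=
  (fun x => p * x) '' X

/-- The set `p⁻¹X = {y | p y ∈ X}`. -/
def leftPullback {S : Type u} [Mul S] (p : S) (X : Set S) : Set S :=
  (fun y => p * y) ⁻¹' X

/-- The principal right ideal `pS`. -/
def principalRightIdeal {S : Type u} [Mul S] (p : S) : Set S :=
  leftTranslate p Set.univ

/-- The right ideal `{p} ∪ pS` generated by `p`. -/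
def generatedRightIdeal {S : Type u} [Mul S] (p : S) : Set S :=
  {p} ∪ principalRightIdeal p

/-- Membership in the smallest family of subsets of `S` that contains `∅` and `S` and is closed
under `X ↦ pX` and `X ↦ p⁻¹X`. -/
inductive IsConstructible {S : Type u} [Mul S] : Set S → Prop
  | empty : IsConstructible ∅
  | univ : IsConstructible Set.univ
  | translate (p : S) {X : Set S} : IsConstructible X → IsConstructible (leftTranslate p X)
  | pullback (p : S) {X : Set S} : IsConstructible X → IsConstructible (leftPullback p X)

/-- The family `𝓙(S)` of constructible right ideals. -/
abbrev ConstructibleIdeal (S : Type u) [Mul S] : Type u :=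
  {X : Set S // IsConstructible X}

/-- `r` is a right least common multiple of `p` and `q`: it is a common multiple (where an element
counts as a multiple of itself) and the common right multiples of `p` and `q` are exactly the right
multiples of `r`. If `S` has an identity then `{p} ∪ pS = pS`, and this is the usual notion. -/
def IsRightLeastCommonMultiple {S : Type u} [Mul S] (p q r : S) : Prop :=
  r ∈ generatedRightIdeal p ∩ generatedRightIdeal q ∧
    principalRightIdeal p ∩ principalRightIdeal q = principalRightIdeal r

/-- A left cancellative semigroup is right LCM if any two elements with a right common multiple
have a right least common multiple. -/
def IsRightLCM (S : Type u) [LeftCancelSemigroup S] : Prop :=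
  ∀ p q : S, (principalRightIdeal p ∩ principalRightIdeal q).Nonempty →
    ∃ r : S, IsRightLeastCommonMultiple p q r

/-- The family of constructible right ideals is closed under intersections. -/
theorem IsConstructible.inter {S : Type u} [LeftCancelSemigroup S] {X Y : Set S}
    (hX : IsConstructible X) (hY : IsConstructible Y) : IsConstructible (X ∩ Y) := by
  induction hX generalizing Y with
  | empty => simpa using IsConstructible.empty
  | univ => simpa using hY
  | @translate p X _ ih =>
    have h : leftTranslate p X ∩ Y = leftTranslate p (X ∩ leftPullback p Y) := by
      ext z
      constructor
      · rintro ⟨⟨x, hx, rfl⟩, hz⟩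
        exact ⟨x, ⟨hx, hz⟩, rfl⟩
      · rintro ⟨x, ⟨hx, hz⟩, rfl⟩
        exact ⟨⟨x, hx, rfl⟩, hz⟩
    rw [h]
    exact (ih (hY.pullback p)).translate p
  | @pullback p X _ ih =>
    have h : leftPullback p X ∩ Y = leftPullback p (X ∩ leftTranslate p Y) := by
      ext z
      constructor
      · rintro ⟨hx, hz⟩
        exact ⟨hx, z, hz, rfl⟩
      · rintro ⟨hx, y, hy, hyz⟩
        have : y = z := mul_left_cancel hyz
        exact ⟨hx, this ▸ hy⟩
    rw [h]
    exact (ih (hY.translate p)).pullback p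

namespace ConstructibleIdeal

/-- The empty constructible ideal. -/
def empty (S : Type u) [Mul S] : ConstructibleIdeal S := ⟨∅, .empty⟩

/-- The constructible ideal `S`. -/
def whole (S : Type u) [Mul S] : ConstructibleIdeal S := ⟨Set.univ, .univ⟩

/-- The constructible ideal `pX`. -/
def translate {S : Type u} [Mul S] (p : S) (X : ConstructibleIdeal S) : ConstructibleIdeal S :=
  ⟨leftTranslate p X.1, X.2.translate p⟩

/-- The constructible ideal `X ∩ Y`. -/
def inter {S : Type u} [LeftCancelSemigroup S] (X Y : ConstructibleIdeal S) :
    ConstructibleIdeal S :=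
  ⟨X.1 ∩ Y.1, X.2.inter Y.2⟩

end ConstructibleIdeal

/-! ### The full semigroup C*-algebra -/

/-- Isometries `v p` and projections `e X` in a unital C*-algebra that satisfy the defining
relations (L1)-(L4) of the full semigroup C*-algebra. -/
structure IsLiFamily {S : Type u} [LeftCancelSemigroup S] {B : Type w} [CStarAlgebra B]
    (v : S → B) (e : ConstructibleIdeal S → B) : Prop where
  isometry : ∀ p, star (v p) * v p = 1
  projection : ∀ X, IsStarProjection (e X)
  L1 : ∀ p q, v p * v q = v (p * q)
  L2 : ∀ p X, v p * e X * star (v p) = e (ConstructibleIdeal.translate p X)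
  L3_empty : e (ConstructibleIdeal.empty S) = 0
  L3_whole : e (ConstructibleIdeal.whole S) = 1
  L4 : ∀ X Y, e X * e Y = e (ConstructibleIdeal.inter X Y)

theorem IsLiFamily.map {S : Type u} [LeftCancelSemigroup S] {B : Type*} [CStarAlgebra B]
    {C : Type*} [CStarAlgebra C] {v : S → B} {e : ConstructibleIdeal S → B}
    (h : IsLiFamily v e) (π : B →⋆ₐ[ℂ] C) :
    IsLiFamily (fun p => π (v p)) (fun X => π (e X)) where
  isometry p := by rw [← map_star, ← map_mul, h.isometry, map_one]
  projection X := (h.projection X).map π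
  L1 p q := by rw [← map_mul, h.L1]
  L2 p X := by rw [← map_star, ← map_mul, ← map_mul, h.L2]
  L3_empty := by rw [h.L3_empty, map_zero]
  L3_whole := by rw [h.L3_whole, map_one]
  L4 X Y := by rw [← map_mul, h.L4]

theorem IsLiFamily.commute {S : Type u} [LeftCancelSemigroup S] {B : Type w} [CStarAlgebra B]
    {v : S → B} {e : ConstructibleIdeal S → B} (h : IsLiFamily v e)
    (X Y : ConstructibleIdeal S) : Commute (e X) (e Y) := by
  unfold Commute SemiconjBy
  rw [h.L4, h.L4]
  congr 1
  exact Subtype.ext (Set.inter_comm _ _)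

/-- A realisation of the defining relations in some nonzero unital C*-algebra. -/
structure LiRepresentation (S : Type u) [LeftCancelSemigroup S] : Type (u + 1) where
  carrier : Type u
  [cstarAlgebra : CStarAlgebra carrier]
  [nontrivial : Nontrivial carrier]
  v : S → carrier
  e : ConstructibleIdeal S → carrier
  isLiFamily : IsLiFamily v e

attribute [instance] LiRepresentation.cstarAlgebra LiRepresentation.nontrivial

/-- The C*-algebra of bounded families indexed by all realisations of the defining relations. -/
def LiProduct (S : Type u) [LeftCancelSemigroup S] : Type (u + 1) :=
  lp (fun ρ : LiRepresentation S => ρ.carrier) ∞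

/-- Bounded families in C*-algebras form a C*-algebra. -/
noncomputable def lpCStarAlgebra {I : Type*} (E : I → Type*) [∀ i, CStarAlgebra (E i)]
    [∀ i, Nontrivial (E i)] : CStarAlgebra (lp E ∞) where

/-- The C*-algebra structure of `LiProduct S`: entrywise operations and the supremum norm. -/
noncomputable def LiProduct.cstarAlgebra (S : Type u) [LeftCancelSemigroup S] :
    CStarAlgebra (LiProduct S) :=
  lpCStarAlgebra (fun ρ : LiRepresentation S => ρ.carrier)

noncomputable instance LiProduct.instCStarAlgebra (S : Type u) [LeftCancelSemigroup S] :
    CStarAlgebra (LiProduct S) :=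
  LiProduct.cstarAlgebra S

theorem norm_le_one_of_isometry {B : Type w} [CStarAlgebra B] [Nontrivial B] {a : B}
    (h : star a * a = 1) : ‖a‖ ≤ 1 := by
  have h1 := CStarRing.norm_star_mul_self (x := a)
  rw [h, CStarRing.norm_one] at h1
  nlinarith [norm_nonneg a]

theorem norm_le_one_of_projection {B : Type w} [CStarAlgebra B] {a : B}
    (h : IsStarProjection a) : ‖a‖ ≤ 1 := by
  have h1 := CStarRing.norm_star_mul_self (x := a)
  rw [h.isSelfAdjoint.star_eq, h.isIdempotentElem.eq] at h1
  by_contra! h2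
  nlinarith

/-- The generator `v p` in the product of all realisations. -/
noncomputable def LiProduct.v {S : Type u} [LeftCancelSemigroup S] (p : S) : LiProduct S :=
  ⟨fun ρ => ρ.v p, memℓp_infty ⟨1, by
    rintro _ ⟨ρ, rfl⟩
    exact norm_le_one_of_isometry (ρ.isLiFamily.isometry p)⟩⟩

/-- The generator `e X` in the product of all realisations. -/
noncomputable def LiProduct.e {S : Type u} [LeftCancelSemigroup S] (X : ConstructibleIdeal S) :
    LiProduct S :=
  ⟨fun ρ => ρ.e X, memℓp_infty ⟨1, by
    rintro _ ⟨ρ, rfl⟩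
    exact norm_le_one_of_projection (ρ.isLiFamily.projection X)⟩⟩

/-- The underlying subalgebra of the full semigroup C*-algebra `C*(S)`, the universal unital C*-algebra generated by isometries
`v p` and projections `e X` subject to the relations: the C*-algebra generated by the two families
in the product of all realisations of the relations. -/
noncomputable def fullSubalgebra (S : Type u) [LeftCancelSemigroup S] :
    StarSubalgebra ℂ (LiProduct S) :=
  (StarAlgebra.adjoin ℂ
    (Set.range (LiProduct.v (S := S)) ∪ Set.range (LiProduct.e (S := S)))).topologicalClosure

/-- The full semigroup C*-algebra `C*(S)`. -/
def FullCStar (S : Type u) [LeftCancelSemigroup S] : Type (u + 1) :=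
  fullSubalgebra S

instance fullSubalgebra.isClosed (S : Type u) [LeftCancelSemigroup S] :
    IsClosed (fullSubalgebra S : Set (LiProduct S)) :=
  StarSubalgebra.isClosed_topologicalClosure _

/-- The C*-algebra structure of `C*(S)`, inherited from the product. -/
noncomputable def FullCStar.cstarAlgebra (S : Type u) [LeftCancelSemigroup S] :
    CStarAlgebra (FullCStar S) :=
  StarSubalgebra.cstarAlgebra (fullSubalgebra S)

noncomputable instance FullCStar.instCStarAlgebra (S : Type u) [LeftCancelSemigroup S] :
    CStarAlgebra (FullCStar S) :=
  FullCStar.cstarAlgebra S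

/-- The generating isometry `v p` of `C*(S)`. -/
noncomputable def FullCStar.v {S : Type u} [LeftCancelSemigroup S] (p : S) : FullCStar S :=
  ⟨LiProduct.v p, StarSubalgebra.le_topologicalClosure _
    (StarAlgebra.subset_adjoin ℂ _ (Or.inl ⟨p, rfl⟩))⟩

/-- The generating projection `e X` of `C*(S)`. -/
noncomputable def FullCStar.e {S : Type u} [LeftCancelSemigroup S] (X : ConstructibleIdeal S) :
    FullCStar S :=
  ⟨LiProduct.e X, StarSubalgebra.le_topologicalClosure _
    (StarAlgebra.subset_adjoin ℂ _ (Or.inr ⟨X, rfl⟩))⟩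

/-- The generators of `C*(S)` satisfy the defining relations. -/
theorem FullCStar.isLiFamily (S : Type u) [LeftCancelSemigroup S] :
    IsLiFamily (FullCStar.v (S := S)) (FullCStar.e (S := S)) where
  isometry p := Subtype.ext (lp.ext (funext fun ρ => ρ.isLiFamily.isometry p))
  projection X :=
    ⟨Subtype.ext (lp.ext (funext fun ρ => (ρ.isLiFamily.projection X).isIdempotentElem)),
      Subtype.ext (lp.ext (funext fun ρ => (ρ.isLiFamily.projection X).isSelfAdjoint))⟩
  L1 p q := Subtype.ext (lp.ext (funext fun ρ => ρ.isLiFamily.L1 p q))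
  L2 p X := Subtype.ext (lp.ext (funext fun ρ => ρ.isLiFamily.L2 p X))
  L3_empty := Subtype.ext (lp.ext (funext fun ρ => ρ.isLiFamily.L3_empty))
  L3_whole := Subtype.ext (lp.ext (funext fun ρ => ρ.isLiFamily.L3_whole))
  L4 X Y := Subtype.ext (lp.ext (funext fun ρ => ρ.isLiFamily.L4 X Y))

/-- Evaluation at a realisation of the relations. -/
noncomputable def FullCStar.eval {S : Type u} [LeftCancelSemigroup S] (ρ : LiRepresentation S) :
    FullCStar S →⋆ₐ[ℂ] ρ.carrier where
  toFun a := (show lp (fun ρ : LiRepresentation S => ρ.carrier) ∞ from a.1) ρ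
  map_one' := rfl
  map_mul' _ _ := rfl
  map_zero' := rfl
  map_add' _ _ := rfl
  commutes' _ := rfl
  map_star' _ := rfl

/-- The universal property of `C*(S)`: a family that satisfies the defining relations is the image
of the generators under exactly one unital *-homomorphism. -/
theorem FullCStar.existsUnique_lift {S : Type u} [LeftCancelSemigroup S] {B : Type u}
    [CStarAlgebra B] [Nontrivial B] {v : S → B} {e : ConstructibleIdeal S → B}
    (h : IsLiFamily v e) :
    ∃! π : FullCStar S →⋆ₐ[ℂ] B,
      (∀ p, π (FullCStar.v p) = v p) ∧ ∀ X, π (FullCStar.e X) = e X := by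
  refine ⟨FullCStar.eval ⟨B, v, e, h⟩, ⟨fun _ => rfl, fun _ => rfl⟩, ?_⟩
  rintro π ⟨hv, he⟩
  have hc (σ : FullCStar S →⋆ₐ[ℂ] B) : Continuous σ :=
    AddMonoidHomClass.continuous_of_bound σ 1 fun a => by
      simpa using NonUnitalStarAlgHom.norm_apply_le σ a
  refine StarAlgHom.ext_topologicalClosure (hc π) (hc _) ?_
  refine StarAlgHom.ext_adjoin ?_
  rintro ⟨x, hx⟩ hx'
  rcases hx' with ⟨p, rfl⟩ | ⟨X, rfl⟩
  · exact hv p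
  · exact he X

/-- The diagonal `𝓓` of `C*(S)`: the C*-subalgebra generated by the projections `e X`. It contains
the unit, since `e S = 1`. -/
noncomputable def diagonal (S : Type u) [LeftCancelSemigroup S] :
    StarSubalgebra ℂ (FullCStar S) :=
  (StarAlgebra.adjoin ℂ (Set.range (FullCStar.e (S := S)))).topologicalClosure

/-! ### The projections `Q_{F,A}` -/

open Classical in
/-- For a commuting family `E` and finite sets `A ⊆ F` of indices, the product
`∏_{i ∈ A} E i * ∏_{j ∈ F \ A} (1 - E j)`. -/
noncomputable def cylinderProjection {ι : Type*} {B : Type*} [Ring B] (E : ι → B)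
    (hE : ∀ i j, Commute (E i) (E j)) (F A : Finset ι) : B :=
  A.noncommProd E (fun i _ j _ _ => hE i j) *
    (F \ A).noncommProd (fun j => 1 - E j) (fun i _ j _ _ =>
      ((Commute.one_left _).sub_left ((Commute.one_right _).sub_right (hE i j))))

/-- The projection `Q^E_{F,A}` of the family `E X = π (e X)`. -/
noncomputable def imageProjection {S : Type u} [LeftCancelSemigroup S] {B : Type w}
    [CStarAlgebra B] (π : FullCStar S →⋆ₐ[ℂ] B) (F A : Finset (ConstructibleIdeal S)) : B :=
  cylinderProjection (fun X => π (FullCStar.e X))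
    (((FullCStar.isLiFamily S).map π).commute) F A

/-! ### Products of commuting idempotents -/

/-! The family `e X` is closed under products and contains `1`, so its linear span is dense in the
diagonal. On a finite combination over `F`, each `Q_{F,A}` is a joint eigenprojection with
eigenvalue the sum of the coefficients over `A`, and by Gelfand theory the norm is attained at some
nonzero `Q_{F,A}`. Hence `π` is isometric on the diagonal once it kills no nonzero `Q_{F,A}`
(`norm_le_norm_map_of_cylinderProjection`). (I) ⇒ (II): a point in the set of (II) gives a basis
vector of `ℓ²(S)` fixed by `Q_{F,A}` in the left regular representation, so `Q_{F,A} ≠ 0` in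
`C*(S)`. (II) ⇒ (III): take `A = {S}`; the set of (II) is non-empty because finitely many proper
constructible ideals never cover `S`. (III) ⇒ (I): if `Q_{F,A} ≠ 0` in `C*(S)`, then `Z = ⋂ A` is
non-empty and lies in no `Y ∈ F \ A`. By right LCM, `Z` is `S` or some `pS`. If `Z = pS`,
compressing `Q^E_{F,A}` by the image of `v p` gives the product of the `1 - E_{p⁻¹Y}`, where `p⁻¹Y ≠
S` because `pS ⊄ Y`; (III) makes it nonzero. -/

theorem mul_noncommProd_of_isIdempotentElem {ι M : Type*} [Monoid M] {s : Finset ι} {f : ι → M}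
    (comm : (s : Set ι).Pairwise (Function.onFun Commute f)) {i : ι} (hi : i ∈ s)
    (hf : IsIdempotentElem (f i)) : f i * s.noncommProd f comm = s.noncommProd f comm := by
  classical
  rw [← Finset.mul_noncommProd_erase s hi f comm, ← mul_assoc, hf.eq]

section Cylinder

variable {ι B : Type*} [Ring B] {E : ι → B}

theorem pairwise_commute (hE : ∀ i j, Commute (E i) (E j)) (s : Finset ι) : (s : Set ι).Pairwise (Function.onFun Commute E) :=
  fun i _ j _ _ => hE i j

theorem commute_one_sub (hE : ∀ i j, Commute (E i) (E j)) (i j : ι) : Commute (1 - E i) (1 - E j) :=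
  (Commute.one_left _).sub_left ((Commute.one_right _).sub_right (hE i j))

/-- Frees the set difference from the classical decidability instance fixed in the definition, so
that rewriting works with any instance. -/
theorem cylinderProjection_def [inst : DecidableEq ι] (hE : ∀ i j, Commute (E i) (E j))
    (F A : Finset ι) :
    cylinderProjection E hE F A =
      A.noncommProd E (pairwise_commute hE A) *
        (F \ A).noncommProd (fun j => 1 - E j) (pairwise_commute (commute_one_sub hE) _) := by
  obtain rfl : inst = fun a b => Classical.propDecidable (a = b) := Subsingleton.elim _ _
  rfl

theorem mul_cylinderProjection_of_mem (hE : ∀ i j, Commute (E i) (E j))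
    {F A : Finset ι} {i : ι} (hi : i ∈ A)
    (hid : IsIdempotentElem (E i)) :
    E i * cylinderProjection E hE F A = cylinderProjection E hE F A := by
  classical
  rw [cylinderProjection_def, ← mul_assoc, mul_noncommProd_of_isIdempotentElem _ hi hid]

theorem mul_cylinderProjection_of_notMem (hE : ∀ i j, Commute (E i) (E j))
    {F A : Finset ι} {i : ι} (hiF : i ∈ F) (hi : i ∉ A)
    (hid : IsIdempotentElem (E i)) :
    E i * cylinderProjection E hE F A = 0 := by
  classical
  have h := mul_noncommProd_of_isIdempotentElem (f := fun j => 1 - E j)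
    (pairwise_commute (commute_one_sub hE) _) (Finset.mem_sdiff.2 ⟨hiF, hi⟩) hid.one_sub
  have hc : Commute (E i) (A.noncommProd E (pairwise_commute hE A)) :=
    Finset.noncommProd_commute _ _ _ _ fun j _ => hE i j
  rw [cylinderProjection_def, ← mul_assoc, hc.eq, mul_assoc, ← h, ← mul_assoc (E i), mul_sub, mul_one,
    hid.eq, sub_self, zero_mul, mul_zero]

theorem map_cylinderProjection {C G : Type*} [Ring C] [FunLike G B C] [RingHomClass G B C]
    (hE : ∀ i j, Commute (E i) (E j)) (f : G) (F A : Finset ι) :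
    f (cylinderProjection E hE F A) =
      cylinderProjection (fun i => f (E i)) (fun i j => (hE i j).map f) F A := by
  classical
  simp only [cylinderProjection_def, map_mul, Finset.map_noncommProd, map_sub, map_one]

theorem sum_smul_mul_cylinderProjection [Algebra ℂ B] (hE : ∀ i j, Commute (E i) (E j))
    (hid : ∀ i, IsIdempotentElem (E i))
    {F A : Finset ι} (hAF : A ⊆ F) (c : ι → ℂ) :
    (∑ i ∈ F, c i • E i) * cylinderProjection E hE F A =
      (∑ i ∈ A, c i) • cylinderProjection E hE F A := by
  rw [Finset.sum_mul, Finset.sum_smul, ← Finset.sum_subset hAF]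
  · refine Finset.sum_congr rfl fun i hi => ?_
    rw [smul_mul_assoc, mul_cylinderProjection_of_mem hE hi (hid i)]
  · intro i hiF hi
    rw [smul_mul_assoc, mul_cylinderProjection_of_notMem hE hiF hi (hid i), smul_zero]

end Cylinder

/-! ### Norms of linear combinations of commuting projections. -/

/-- Multiply by the eigenprojection and cancel its norm, which only has to be positive. -/
theorem norm_sum_le_of_cylinderProjection_ne_zero {ι B : Type*} [CStarAlgebra B] {E : ι → B}
    (hE : ∀ i j, Commute (E i) (E j)) (hid : ∀ i, IsIdempotentElem (E i)) {F A : Finset ι}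
    (hAF : A ⊆ F) (c : ι → ℂ) (h : cylinderProjection E hE F A ≠ 0) :
    ‖∑ i ∈ A, c i‖ ≤ ‖∑ i ∈ F, c i • E i‖ := by
  refine le_of_mul_le_mul_right ?_ (norm_pos_iff.2 h)
  rw [← norm_smul, ← sum_smul_mul_cylinderProjection hE hid hAF]
  exact norm_mul_le _ _

open Classical in
/-- A character takes the value `1` on the cylinder projection that it selects. -/
theorem map_cylinderProjection_filter {ι A : Type*} [CommRing A] [Algebra ℂ A] {e : ι → A}
    (he : ∀ i j, Commute (e i) (e j)) (hid : ∀ i, IsIdempotentElem (e i)) (χ : A →ₐ[ℂ] ℂ)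
    (F : Finset ι) : χ (cylinderProjection e he F (F.filter fun i => χ (e i) = 1)) = 1 := by
  have h01 (i : ι) : χ (e i) = 0 ∨ χ (e i) = 1 :=
    IsIdempotentElem.iff_eq_zero_or_one.1 ((hid i).map χ)
  rw [map_cylinderProjection, cylinderProjection_def, Finset.noncommProd_eq_prod,
    Finset.noncommProd_eq_prod, Finset.prod_eq_one, Finset.prod_eq_one, one_mul]
  · intro i hi
    simp only [Finset.mem_sdiff, Finset.mem_filter, not_and] at hi
    rw [(h01 i).resolve_right (hi.2 hi.1), sub_zero]
  · intro i hi
    exact (Finset.mem_filter.1 hi).2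

/-- The Gelfand transform is isometric and the character space is compact, so the supremum norm is
attained. -/
theorem exists_character_norm_eq {A : Type*} [CommCStarAlgebra A] [Nontrivial A] (x : A) :
    ∃ χ : A →ₐ[ℂ] ℂ, ‖χ x‖ = ‖x‖ := by
  obtain ⟨χ, -, hχ⟩ := isCompact_univ.exists_isMaxOn (Set.univ_nonempty)
    (WeakDual.gelfandTransform ℂ A x).continuous.norm.continuousOn
  refine ⟨WeakDual.CharacterSpace.toAlgHom χ, ?_⟩
  rw [← (gelfandTransform_isometry A).norm_map_of_map_zero (map_zero _) x]
  exact le_antisymm (ContinuousMap.norm_coe_le_norm (WeakDual.gelfandTransform ℂ A x) χ)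
    ((ContinuousMap.norm_le _ (norm_nonneg _)).2 fun ψ => hχ (Set.mem_univ ψ))

/-- For a character `χ` attaining the norm, take `Z` to be the indices with `χ (e i) = 1`. Then `χ`
is `1` on the cylinder projection, and applying `χ` to the eigenvalue equation evaluates the norm.
-/
theorem exists_cylinderProjection_ne_zero_norm_sum_eq {ι A : Type*} [CommCStarAlgebra A]
    [Nontrivial A] {e : ι → A} (he : ∀ i j, Commute (e i) (e j))
    (hid : ∀ i, IsIdempotentElem (e i)) (F : Finset ι) (c : ι → ℂ) :
    ∃ Z ⊆ F, cylinderProjection e he F Z ≠ 0 ∧ ‖∑ i ∈ F, c i • e i‖ = ‖∑ i ∈ Z, c i‖ := by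
  classical
  obtain ⟨χ, hχ⟩ := exists_character_norm_eq (∑ i ∈ F, c i • e i)
  have h1 := map_cylinderProjection_filter he hid χ F
  refine ⟨F.filter fun i => χ (e i) = 1, Finset.filter_subset _ _, ?_, ?_⟩
  · intro h
    rw [h, map_zero] at h1
    exact zero_ne_one h1
  · have h2 := congrArg χ
      (sum_smul_mul_cylinderProjection he hid (Finset.filter_subset (fun i => χ (e i) = 1) F) c)
    rw [map_mul, map_smul, h1, mul_one, smul_eq_mul, mul_one] at h2
    rw [← hχ, h2]

/-- A *-homomorphism that kills no nonzero cylinder projection of a commuting family of projections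
which is closed under products and contains `1` is isometric on the C*-algebra they generate. -/
theorem norm_le_norm_map_of_cylinderProjection {ι A B : Type*} [CStarAlgebra A] [CStarAlgebra B]
    {e : ι → A} (he : ∀ i j, Commute (e i) (e j)) (hp : ∀ i, IsStarProjection (e i))
    (hmul : ∀ i j, ∃ k, e i * e j = e k) (hone : ∃ k, e k = 1) (π : A →⋆ₐ[ℂ] B)
    (hπ : ∀ F Z : Finset ι, Z ⊆ F → cylinderProjection e he F Z ≠ 0 →
      cylinderProjection (fun i => π (e i)) (fun i j => (he i j).map π) F Z ≠ 0)
    {x : A} (hx : x ∈ (StarAlgebra.adjoin ℂ (Set.range e)).topologicalClosure) :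
    ‖x‖ ≤ ‖π x‖ := by
  have hcont : Continuous π := AddMonoidHomClass.continuous_of_bound π 1 fun a => by
    simpa using NonUnitalStarAlgHom.norm_apply_le π a
  have hclosed : IsClosed {x : A | ‖x‖ ≤ ‖π x‖} := isClosed_le continuous_norm hcont.norm
  refine closure_minimal (fun z hz => ?_) hclosed hx
  set D := (StarAlgebra.adjoin ℂ (Set.range e)).topologicalClosure
  have hstar : star (Set.range e) = Set.range e := by
    ext y
    constructor
    · rintro ⟨i, hi⟩
      exact ⟨i, by rw [← star_star y, ← hi, (hp i).isSelfAdjoint.star_eq]⟩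
    · rintro ⟨i, rfl⟩
      exact ⟨i, (hp i).isSelfAdjoint.star_eq.symm⟩
  -- The generators already form a submonoid, so the star algebra they generate is their linear
  -- span.
  have hclos : (Submonoid.closure (Set.range e) : Set A) = Set.range e := by
    refine le_antisymm (fun y hy => ?_) Submonoid.subset_closure
    induction hy using Submonoid.closure_induction with
    | mem y hy => exact hy
    | one => exact hone
    | mul y z _ _ hy hz =>
      obtain ⟨i, rfl⟩ := hy
      obtain ⟨j, rfl⟩ := hz
      obtain ⟨k, hk⟩ := hmul i j
      exact ⟨k, hk.symm⟩
  have hspan : z ∈ Submodule.span ℂ (Set.range e) := by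
    have h := StarAlgebra.adjoin_eq_span (R := ℂ) (Set.range e)
    rw [hstar, Set.union_self, hclos] at h
    rw [← h]
    exact hz
  obtain ⟨c, rfl⟩ := Finsupp.mem_span_range_iff_exists_finsupp.1 hspan
  have hcomm (y z : StarAlgebra.adjoin ℂ (Set.range e)) : y * z = z * y := by
    have := StarAlgebra.isMulCommutative_adjoin ℂ (s := Set.range e)
      (by rintro _ ⟨i, rfl⟩ _ ⟨j, rfl⟩; exact he i j)
      (by
        rintro _ ⟨i, rfl⟩ _ ⟨j, rfl⟩
        rw [(hp j).isSelfAdjoint.star_eq]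
        exact he i j)
    exact mul_comm' y z
  have : IsClosed (D : Set A) := StarSubalgebra.isClosed_topologicalClosure _
  -- Gelfand theory needs a commutative algebra, so the norm is computed in `D` rather than in `A`.
  let _ : CommCStarAlgebra D :=
    { StarSubalgebra.cstarAlgebra D with
      mul_comm := (StarSubalgebra.commRingTopologicalClosure _ hcomm).mul_comm }
  rcases subsingleton_or_nontrivial A with hA | hA
  · simp [Subsingleton.elim (c.sum fun i a => a • e i) 0]
  let e' (i : ι) : D := ⟨e i, StarSubalgebra.le_topologicalClosure _
    (StarAlgebra.subset_adjoin ℂ _ ⟨i, rfl⟩)⟩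
  have he' (i j : ι) : Commute (e' i) (e' j) := Subtype.ext (he i j)
  obtain ⟨Z, hZ, hne, hnorm⟩ := exists_cylinderProjection_ne_zero_norm_sum_eq (e := e')
    he' (fun i => Subtype.ext (hp i).isIdempotentElem) c.support c
  have hne' : cylinderProjection e he c.support Z ≠ 0 := by
    intro h
    refine hne (Subtype.ext ?_)
    exact (map_cylinderProjection (E := e') he' D.subtype c.support Z).trans h
  have hsum : ‖c.sum fun i a => a • e i‖ = ‖∑ i ∈ c.support, c i • e' i‖ := by
    exact congrArg norm (map_sum D.subtype (fun i => c i • e' i) c.support).symm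
  rw [Set.mem_ofPred_eq, hsum, hnorm]
  have h := norm_sum_le_of_cylinderProjection_ne_zero (fun i j => (he i j).map π)
    (fun i => (hp i).isIdempotentElem.map π) hZ c (hπ _ _ hZ hne')
  rwa [Finsupp.sum, map_sum, Finset.sum_congr rfl fun i _ => map_smul π (c i) (e i)]

/-! ### The left regular representation -/

namespace LeftRegular

variable {S : Type u} {H : Type*} [NormedAddCommGroup H] [InnerProductSpace ℂ H]

theorem ext_hilbertBasis (b : HilbertBasis S ℂ H) {T T' : H →L[ℂ] H}
    (h : ∀ s, T (b s) = T' (b s)) : T = T' :=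
  ContinuousLinearMap.ext_on (Submodule.dense_iff_topologicalClosure_eq_top.2 b.dense_span)
    (by rintro _ ⟨s, rfl⟩; exact h s)

variable [CompleteSpace H]

/-- The operator that maps the basis vector at `s` to the basis vector at `p s`. -/
noncomputable def shift [LeftCancelSemigroup S] (b : HilbertBasis S ℂ H) (p : S) : H →L[ℂ] H :=
  ((b.orthonormal.comp (fun s => p * s)
    (mul_right_injective p)).orthogonalFamily.linearIsometry.comp
      b.repr.toLinearIsometry).toContinuousLinearMap

/-- The orthogonal projection onto the closed span of the basis vectors at points of `X`. -/
noncomputable def indicator (b : HilbertBasis S ℂ H) (X : Set S) : H →L[ℂ] H :=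
  (Submodule.span ℂ (b '' X)).topologicalClosure.starProjection

theorem indicator_apply_of_mem (b : HilbertBasis S ℂ H) {X : Set S} {s : S} (hs : s ∈ X) :
    indicator b X (b s) = b s :=
  Submodule.starProjection_eq_self_iff.2
    (Submodule.le_topologicalClosure _ (Submodule.subset_span ⟨s, hs, rfl⟩))

theorem indicator_apply_of_notMem (b : HilbertBasis S ℂ H) {X : Set S} {s : S} (hs : s ∉ X) :
    indicator b X (b s) = 0 := by
  refine (Submodule.starProjection_apply_eq_zero_iff _).2 ?_
  rw [Submodule.orthogonal_closure, Submodule.mem_orthogonal]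
  intro y hy
  induction hy using Submodule.span_induction with
  | mem y hy =>
    obtain ⟨t, ht, rfl⟩ := hy
    exact b.orthonormal.2 (by rintro rfl; exact hs ht)
  | zero => exact inner_zero_left _
  | add y z _ _ hy hz => rw [inner_add_left, hy, hz, add_zero]
  | smul c y _ hy => rw [inner_smul_left, hy, mul_zero]

theorem indicator_mul (b : HilbertBasis S ℂ H) (X Y : Set S) :
    indicator b X * indicator b Y = indicator b (X ∩ Y) := by
  refine ext_hilbertBasis b fun s => ?_
  rw [mul_apply_eq_comp]
  by_cases hY : s ∈ Y
  · rw [indicator_apply_of_mem b hY]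
    by_cases hX : s ∈ X
    · rw [indicator_apply_of_mem b hX, indicator_apply_of_mem b (X := X ∩ Y) ⟨hX, hY⟩]
    · rw [indicator_apply_of_notMem b hX, indicator_apply_of_notMem b fun h => hX h.1]
  · rw [indicator_apply_of_notMem b hY, indicator_apply_of_notMem b fun h => hY h.2, map_zero]

section Shift

variable [LeftCancelSemigroup S]

theorem shift_apply (b : HilbertBasis S ℂ H) (p s : S) : shift b p (b s) = b (p * s) := by
  classical
  have h := (b.orthonormal.comp (fun s => p * s)
    (mul_right_injective p)).orthogonalFamily.linearIsometry_apply_single (i := s) (1 : ℂ)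
  rw [LinearIsometry.toSpanSingleton_apply, one_smul] at h
  rw [← Function.comp_apply (f := b) (g := fun s => p * s), ← h, ← b.repr_self]
  rfl

theorem star_shift_mul_shift (b : HilbertBasis S ℂ H) (p : S) :
    star (shift b p) * shift b p = 1 := by
  rw [ContinuousLinearMap.star_eq_adjoint]
  exact (ContinuousLinearMap.norm_map_iff_adjoint_comp_self _).1 fun x =>
    LinearIsometry.norm_map _ x

theorem star_shift_apply_mul (b : HilbertBasis S ℂ H) (p s : S) :
    star (shift b p) (b (p * s)) = b s := by
  rw [← shift_apply, ← mul_apply_eq_comp, star_shift_mul_shift]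
  rfl

/-- Its coefficient at `s` is the inner product of the basis vectors at `p * s` and `t`, which are
distinct. -/
theorem star_shift_apply_of_notMem (b : HilbertBasis S ℂ H) {p t : S}
    (ht : t ∉ principalRightIdeal p) : star (shift b p) (b t) = 0 := by
  refine b.repr.injective ?_
  rw [map_zero]
  ext s
  rw [b.repr_apply_apply, ContinuousLinearMap.star_eq_adjoint,
    ContinuousLinearMap.adjoint_inner_right, shift_apply]
  exact b.orthonormal.2 fun h => ht ⟨s, Set.mem_univ s, h⟩

theorem isLiFamily (b : HilbertBasis S ℂ H) :
    IsLiFamily (shift b) (fun X : ConstructibleIdeal S => indicator b X.1) where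
  isometry := star_shift_mul_shift b
  projection X := isStarProjection_starProjection
  L1 p q := ext_hilbertBasis b fun s => by
    rw [mul_apply_eq_comp, shift_apply, shift_apply, shift_apply, mul_assoc]
  L2 p X := ext_hilbertBasis b fun t => by
    rw [mul_apply_eq_comp, mul_apply_eq_comp]
    by_cases ht : t ∈ principalRightIdeal p
    · obtain ⟨s, -, rfl⟩ := ht
      dsimp only
      rw [star_shift_apply_mul]
      by_cases hs : s ∈ X.1
      · rw [indicator_apply_of_mem b hs, shift_apply]
        exact (indicator_apply_of_mem b (X := leftTranslate p X.1) ⟨s, hs, rfl⟩).symm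
      · rw [indicator_apply_of_notMem b hs, map_zero, indicator_apply_of_notMem b]
        rintro ⟨s', hs', h⟩
        exact hs (mul_left_cancel h ▸ hs')
    · rw [star_shift_apply_of_notMem b ht, map_zero, map_zero, indicator_apply_of_notMem b]
      rintro ⟨s, -, rfl⟩
      exact ht ⟨s, Set.mem_univ s, rfl⟩
  L3_empty := ext_hilbertBasis b fun s => indicator_apply_of_notMem b (Set.notMem_empty s)
  L3_whole := ext_hilbertBasis b fun s => indicator_apply_of_mem b (Set.mem_univ s)
  L4 X Y := indicator_mul b X.1 Y.1

end Shift

end LeftRegular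

/-! ### Cylinder projections that are nonzero in the full algebra. -/

theorem noncommProd_apply_eq_self {ι H : Type*} [NormedAddCommGroup H] [NormedSpace ℂ H]
    {s : Finset ι} {f : ι → H →L[ℂ] H} (comm : (s : Set ι).Pairwise (Function.onFun Commute f))
    {x : H} (h : ∀ i ∈ s, f i x = x) : s.noncommProd f comm x = x :=
  Finset.noncommProd_induction s f comm (fun T => T x = x)
    (fun S T hS hT => by rw [mul_apply_eq_comp, hT, hS]) rfl h

theorem FullCStar.cylinderProjection_ne_zero {S : Type u} [LeftCancelSemigroup S] [Nonempty S]
    {F A : Finset (ConstructibleIdeal S)}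
    (h : ((⋂ X ∈ A, (X : Set S)) ∩ ⋂ Y ∈ F, ⋂ _ : Y ∉ A, (Y : Set S)ᶜ).Nonempty) :
    cylinderProjection (FullCStar.e (S := S)) (FullCStar.isLiFamily S).commute F A ≠ 0 := by
  classical
  obtain ⟨s, hsA, hsF⟩ := h
  simp only [Set.mem_iInter, Set.mem_compl_iff] at hsA hsF
  -- The default Hilbert basis is the standard basis of `ℓ²(S)`.
  let b : HilbertBasis S ℂ (lp (fun _ : S => ℂ) 2) := default
  have hb : b s ≠ 0 := b.orthonormal.ne_zero s
  have : Nontrivial (lp (fun _ : S => ℂ) 2) := ⟨b s, 0, hb⟩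
  intro h0
  obtain ⟨σ, ⟨-, hσ⟩, -⟩ := FullCStar.existsUnique_lift (LeftRegular.isLiFamily b)
  have h1 := congrArg σ h0
  rw [map_cylinderProjection, map_zero, cylinderProjection_def] at h1
  have hA (X) (hX : X ∈ A) : σ (FullCStar.e X) (b s) = b s := by
    rw [hσ]
    exact LeftRegular.indicator_apply_of_mem b (hsA X hX)
  have hF (Y) (hY : Y ∈ F \ A) : (1 - σ (FullCStar.e Y)) (b s) = b s := by
    rw [Finset.mem_sdiff] at hY
    rw [hσ, sub_apply, LeftRegular.indicator_apply_of_notMem b (hsF Y hY.1 hY.2), sub_zero]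
    rfl
  have h2 := congrArg (fun T => T (b s)) h1
  simp only [mul_apply_eq_comp] at h2
  rw [noncommProd_apply_eq_self _ hF, noncommProd_apply_eq_self _ hA] at h2
  exact hb h2

/-! ### Constructible right ideals of right LCM semigroups -/

section Ideals

variable {S : Type u} [LeftCancelSemigroup S]

theorem leftTranslate_principalRightIdeal (p q : S) :
    leftTranslate p (principalRightIdeal q) = principalRightIdeal (p * q) := by
  simp only [principalRightIdeal, leftTranslate, Set.image_image, mul_assoc]

theorem leftPullback_leftTranslate (p : S) (X : Set S) :
    leftPullback p (leftTranslate p X) = X :=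
  Set.preimage_image_eq X (mul_right_injective p)

theorem leftPullback_inter_principalRightIdeal (p : S) (X : Set S) :
    leftPullback p (principalRightIdeal p ∩ X) = leftPullback p X := by
  ext y
  exact ⟨fun h => h.2, fun h => ⟨⟨y, Set.mem_univ y, rfl⟩, h⟩⟩

theorem leftTranslate_leftPullback (p : S) (X : Set S) :
    leftTranslate p (leftPullback p X) = principalRightIdeal p ∩ X := by
  ext y
  constructor
  · rintro ⟨z, hz, rfl⟩
    exact ⟨⟨z, Set.mem_univ z, rfl⟩, hz⟩
  · rintro ⟨⟨z, -, rfl⟩, hz⟩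
    exact ⟨z, hz, rfl⟩

/-- In a right LCM semigroup every constructible right ideal is empty, everything or principal. -/
theorem IsConstructible.eq_empty_or_univ_or_principal (hS : IsRightLCM S) {X : Set S}
    (hX : IsConstructible X) :
    X = ∅ ∨ X = Set.univ ∨ ∃ p, X = principalRightIdeal p := by
  induction hX with
  | empty => exact .inl rfl
  | univ => exact .inr (.inl rfl)
  | @translate p X _ ih =>
    rcases ih with rfl | rfl | ⟨q, rfl⟩
    · exact .inl (Set.image_empty _)
    · exact .inr (.inr ⟨p, rfl⟩)
    · exact .inr (.inr ⟨p * q, leftTranslate_principalRightIdeal p q⟩)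
  | @pullback p X _ ih =>
    rcases ih with rfl | rfl | ⟨q, rfl⟩
    · exact .inl Set.preimage_empty
    · exact .inr (.inl Set.preimage_univ)
    -- The pullback only sees `pS ∩ qS = rS`. Since `r` is `p` or some `p * t`, cancelling `p`
    -- leaves `S` or `tS`.
    · rw [← leftPullback_inter_principalRightIdeal]
      rcases Set.eq_empty_or_nonempty (principalRightIdeal p ∩ principalRightIdeal q) with h | h
      · rw [h]
        exact .inl Set.preimage_empty
      · obtain ⟨r, ⟨hr, -⟩, hpq⟩ := hS p q h
        rw [hpq]
        rcases hr with rfl | ⟨t, -, rfl⟩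
        · exact .inr (.inl (leftPullback_leftTranslate _ _))
        · refine .inr (.inr ⟨t, ?_⟩)
          dsimp only
          rw [← leftTranslate_principalRightIdeal, leftPullback_leftTranslate]

/-! ### Finite families of proper ideals do not cover the semigroup. -/

theorem principalRightIdeal_subset {p q : S} (h : p ∈ principalRightIdeal q) :
    principalRightIdeal p ⊆ principalRightIdeal q := by
  obtain ⟨t, -, rfl⟩ := h
  rintro _ ⟨x, -, rfl⟩
  exact ⟨t * x, Set.mem_univ _, (mul_assoc q t x).symm⟩

theorem principalRightIdeal_eq_univ_of_left_identity {p e : S} (he : ∀ x, e * x = x)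
    (h : e ∈ principalRightIdeal p) : principalRightIdeal p = Set.univ := by
  refine Set.univ_subset_iff.1 ((principalRightIdeal_subset h).trans' fun x _ => ?_)
  exact ⟨x, Set.mem_univ x, he x⟩

/-- A left cancellative semigroup is not a finite union of proper principal right ideals. -/
theorem exists_forall_notMem_principalRightIdeal [Nonempty S] (G : Finset S)
    (hG : ∀ p ∈ G, principalRightIdeal p ≠ Set.univ) :
    ∃ s, ∀ p ∈ G, s ∉ principalRightIdeal p := by
  classical
  induction G using Finset.strongInduction with
  | H G ih =>
    by_contra! hcov
    obtain ⟨p₀, hp₀, -⟩ := hcov (Classical.arbitrary S)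
    -- The generator `p₀` is itself covered by some `qS`, although it need not lie in `p₀S`.
    obtain ⟨q, hq, hpq⟩ := hcov p₀
    rcases eq_or_ne p₀ q with rfl | hne
    -- From `p₀ * e = p₀`, left cancellation makes `e` a left identity, so the ideal containing `e`
    -- is all of `S`.
    · obtain ⟨e, -, he⟩ := hpq
      have hid (x : S) : e * x = x :=
        mul_left_cancel (a := p₀) (by rw [← mul_assoc]; exact congrArg (· * x) he)
      obtain ⟨r, hr, her⟩ := hcov e
      exact hG r hr (principalRightIdeal_eq_univ_of_left_identity hid her)
    -- Here `p₀S ⊆ qS`, so `p₀` is redundant in the cover.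
    · obtain ⟨s, hs⟩ := ih (G.erase p₀) (Finset.erase_ssubset hp₀)
        fun p hp => hG p (Finset.mem_of_mem_erase hp)
      obtain ⟨r, hr, hsr⟩ := hcov s
      rcases eq_or_ne r p₀ with rfl | hr'
      · exact hs q (Finset.mem_erase.2 ⟨hne.symm, hq⟩) (principalRightIdeal_subset hpq hsr)
      · exact hs r (Finset.mem_erase.2 ⟨hr', hr⟩) hsr

theorem exists_forall_notMem_constructibleIdeal [Nonempty S] (hS : IsRightLCM S)
    (F : Finset (ConstructibleIdeal S)) (hF : ∀ X ∈ F, (X : Set S) ≠ Set.univ) :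
    ∃ s, ∀ X ∈ F, s ∉ (X : Set S) := by
  classical
  choose g hg using fun X : {X : ConstructibleIdeal S // X ∈ F ∧ (X : Set S) ≠ ∅} =>
    (X.1.2.eq_empty_or_univ_or_principal hS).resolve_left X.2.2 |>.resolve_left (hF _ X.2.1)
  have : Finite {X : ConstructibleIdeal S // X ∈ F ∧ (X : Set S) ≠ ∅} :=
    (F.finite_toSet.subset fun X h => h.1 :
      {X : ConstructibleIdeal S | X ∈ F ∧ (X : Set S) ≠ ∅}.Finite)
  obtain ⟨s, hs⟩ := exists_forall_notMem_principalRightIdeal (Set.finite_range g).toFinset (by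
    intro p hp
    obtain ⟨X, rfl⟩ := (Set.Finite.mem_toFinset _).1 hp
    rw [← hg]
    exact hF _ X.2.1)
  refine ⟨s, fun X hX hsX => ?_⟩
  have hne : (X : Set S) ≠ ∅ := fun h => by simp [h] at hsX
  refine hs (g ⟨X, hX, hne⟩) ((Set.Finite.mem_toFinset _).2 ⟨_, rfl⟩) ?_
  rw [← hg]
  exact hsX

/-- The constructible ideal `p⁻¹X`. -/
def ConstructibleIdeal.pullback (p : S) (X : ConstructibleIdeal S) : ConstructibleIdeal S :=
  ⟨leftPullback p X.1, X.2.pullback p⟩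

theorem exists_constructibleIdeal_eq_iInter (A : Finset (ConstructibleIdeal S)) :
    ∃ Z : ConstructibleIdeal S, (Z : Set S) = ⋂ X ∈ A, (X : Set S) := by
  classical
  induction A using Finset.induction_on with
  | empty => exact ⟨.whole S, by simp [ConstructibleIdeal.whole]⟩
  | insert X A _ ih =>
    obtain ⟨Z, hZ⟩ := ih
    exact ⟨.inter X Z, by rw [Finset.set_biInter_insert, ← hZ]; rfl⟩

end Ideals

/-! ### Cylinder projections of a family satisfying the defining relations -/

namespace IsLiFamily

variable {S : Type u} [LeftCancelSemigroup S] {B : Type*} [CStarAlgebra B] {v : S → B}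
  {e : ConstructibleIdeal S → B}

theorem mul_eq_of_coe_eq_inter (h : IsLiFamily v e) {X Y Z : ConstructibleIdeal S}
    (hZ : (Z : Set S) = (X : Set S) ∩ (Y : Set S)) : e X * e Y = e Z := by
  rw [h.L4]
  exact congrArg e (Subtype.ext hZ.symm)

theorem noncommProd_eq (h : IsLiFamily v e) (A : Finset (ConstructibleIdeal S))
    {Z : ConstructibleIdeal S} (hZ : (Z : Set S) = ⋂ X ∈ A, (X : Set S)) :
    A.noncommProd e (pairwise_commute h.commute A) = e Z := by
  classical
  induction A using Finset.induction_on generalizing Z with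
  | empty =>
    rw [Finset.noncommProd_empty, ← h.L3_whole]
    exact congrArg e (Subtype.ext (by rw [hZ]; simp [ConstructibleIdeal.whole]))
  | insert X A hX ih =>
    obtain ⟨Y, hY⟩ := exists_constructibleIdeal_eq_iInter A
    rw [Finset.noncommProd_insert_of_notMem _ _ _ _ hX, ih hY]
    exact h.mul_eq_of_coe_eq_inter (by rw [hZ, Finset.set_biInter_insert, hY])

theorem v_mul_e (h : IsLiFamily v e) (p : S) (X : ConstructibleIdeal S) :
    v p * e X = e (X.translate p) * v p := by
  rw [← h.L2, mul_assoc, h.isometry, mul_one]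

/-- Follows from `e_{pS} v_p = v_p` and `pS ∩ X = p(p⁻¹X)`; it lets `v p` move past the factors of a
cylinder projection. -/
theorem e_mul_v (h : IsLiFamily v e) (p : S) (X : ConstructibleIdeal S) :
    e X * v p = v p * e (X.pullback p) := by
  have h1 : e ((ConstructibleIdeal.whole S).translate p) * v p = v p := by
    rw [← h.v_mul_e, h.L3_whole, mul_one]
  have h2 : e ((ConstructibleIdeal.whole S).translate p) * e X = e ((X.pullback p).translate p) :=
    h.mul_eq_of_coe_eq_inter (leftTranslate_leftPullback p X.1)
  rw [h.v_mul_e, ← h2, (h.commute _ X).eq, mul_assoc, h1]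

theorem noncommProd_one_sub_mul_v (h : IsLiFamily v e) (p : S)
    (G : Finset (ConstructibleIdeal S)) :
    G.noncommProd (fun Y => 1 - e Y) (pairwise_commute (commute_one_sub h.commute) G) * v p =
      v p * G.noncommProd (fun Y => 1 - e (Y.pullback p))
        (pairwise_commute (commute_one_sub fun X Y => h.commute (X.pullback p) (Y.pullback p))
          G) := by
  classical
  induction G using Finset.induction_on with
  | empty => simp
  | insert X G hX ih =>
    rw [Finset.noncommProd_insert_of_notMem _ _ _ _ hX,
      Finset.noncommProd_insert_of_notMem _ _ _ _ hX, mul_assoc, ih, ← mul_assoc, ← mul_assoc,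
      sub_mul, mul_sub, one_mul, mul_one, h.e_mul_v]

-- Different `Y` may have the same pullback, so the product over `G` can repeat factors of the
-- product over the image. Idempotence absorbs the repetitions.
open Classical in
theorem noncommProd_image_eq_zero (h : IsLiFamily v e) (p : S)
    (G : Finset (ConstructibleIdeal S))
    (h0 : G.noncommProd (fun Y => 1 - e (Y.pullback p))
        (pairwise_commute (commute_one_sub fun X Y => h.commute (X.pullback p) (Y.pullback p))
          G) = 0) :
    (G.image fun Y => Y.pullback p).noncommProd (fun Y => 1 - e Y)
      (pairwise_commute (commute_one_sub h.commute) _) = 0 := by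
  set P := (G.image fun Y => Y.pullback p).noncommProd (fun Y => 1 - e Y)
    (pairwise_commute (commute_one_sub h.commute) _)
  have key : G.noncommProd (fun Y => 1 - e (Y.pullback p))
      (pairwise_commute (commute_one_sub fun X Y => h.commute (X.pullback p) (Y.pullback p))
        G) * P = P := by
    refine Finset.noncommProd_induction G _ _ (fun T => T * P = P)
      (fun a b ha hb => by rw [mul_assoc, hb, ha]) (one_mul P) fun Y hY => ?_
    exact mul_noncommProd_of_isIdempotentElem
      (pairwise_commute (commute_one_sub h.commute) (G.image fun Y => Y.pullback p))
      (Finset.mem_image_of_mem _ hY) (h.projection _).isIdempotentElem.one_sub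
  rw [← key, h0, zero_mul]

theorem cylinderProjection_empty_right (h : IsLiFamily v e) (F : Finset (ConstructibleIdeal S)) :
    cylinderProjection e h.commute F ∅ =
      F.noncommProd (fun Y => 1 - e Y) (pairwise_commute (commute_one_sub h.commute) F) := by
  classical
  rw [cylinderProjection_def, Finset.noncommProd_empty, one_mul]
  exact Finset.noncommProd_congr (Finset.sdiff_empty) (fun _ _ => rfl) _

open Classical in
/-- If all cylinder projections avoiding finitely many proper ideals are nonzero, then so is every
cylinder projection that is not forced to vanish by an inclusion of ideals. -/
theorem cylinderProjection_ne_zero [Nonempty S] (hS : IsRightLCM S) (h : IsLiFamily v e)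
    (hIII : ∀ F : Finset (ConstructibleIdeal S), F.Nonempty →
      (∀ X ∈ F, (X : Set S) ≠ Set.univ) → cylinderProjection e h.commute F ∅ ≠ 0)
    {F A : Finset (ConstructibleIdeal S)} (hne : (⋂ X ∈ A, (X : Set S)).Nonempty)
    (hY : ∀ Y ∈ F, Y ∉ A → ¬ (⋂ X ∈ A, (X : Set S)) ⊆ Y) :
    cylinderProjection e h.commute F A ≠ 0 := by
  -- Adjoining `∅`, whose factor is `1 - e ∅ = 1`, extends the hypothesis to empty `G`.
  have hprod (G : Finset (ConstructibleIdeal S)) (hG : ∀ X ∈ G, (X : Set S) ≠ Set.univ) :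
      G.noncommProd (fun Y => 1 - e Y) (pairwise_commute (commute_one_sub h.commute) G) ≠ 0 := by
    have h1 := hIII (insert (.empty S) G) (Finset.insert_nonempty _ _) (by
      intro X hX
      rcases Finset.mem_insert.1 hX with rfl | hX
      · exact Set.empty_ne_univ
      · exact hG X hX)
    rw [h.cylinderProjection_empty_right] at h1
    by_cases hmem : ConstructibleIdeal.empty S ∈ G
    · rwa [Finset.noncommProd_congr (Finset.insert_eq_of_mem hmem) fun _ _ => rfl] at h1
    · rwa [Finset.noncommProd_insert_of_notMem _ _ _ _ hmem, h.L3_empty, sub_zero, one_mul] at h1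
  obtain ⟨Z, hZ⟩ := exists_constructibleIdeal_eq_iInter A
  rw [cylinderProjection_def, h.noncommProd_eq A hZ]
  rw [← hZ] at hne hY
  rcases Z.2.eq_empty_or_univ_or_principal hS with h0 | h1 | ⟨p, hp⟩
  · exact absurd h0 hne.ne_empty
  · have hZ1 : e Z = 1 := h.L3_whole ▸ congrArg e (Subtype.ext h1)
    rw [hZ1, one_mul]
    refine hprod _ fun Y hYF hY1 => ?_
    rw [Finset.mem_sdiff] at hYF
    exact hY Y hYF.1 hYF.2 (hY1 ▸ Set.subset_univ _)
  · intro h0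
    have hZv : e Z * v p = v p := by
      have : Z = (ConstructibleIdeal.whole S).translate p := Subtype.ext hp
      rw [this, ← h.v_mul_e, h.L3_whole, mul_one]
    -- Compression by `v p` removes `e Z` and turns each `Y` into `p⁻¹Y`.
    have h2 := congrArg (fun T => star (v p) * (T * v p)) h0
    rw [mul_assoc (e Z), h.noncommProd_one_sub_mul_v, ← mul_assoc (e Z), hZv, ← mul_assoc,
      h.isometry, one_mul, zero_mul, mul_zero] at h2
    refine hprod _ (fun X hX => ?_) (h.noncommProd_image_eq_zero p _ h2)
    obtain ⟨Y, hYF, rfl⟩ := Finset.mem_image.1 hX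
    rw [Finset.mem_sdiff] at hYF
    intro huniv
    refine hY Y hYF.1 hYF.2 ?_
    rw [hp]
    rintro _ ⟨x, -, rfl⟩
    exact huniv.ge (Set.mem_univ x)

/-- With `Z = ⋂ A`, the factor `e Z` absorbs into the cylinder projection `Q`. If `Z ⊆ Y`, then `e Z
= e Z * e Y`, while `e Y * Q = 0`. -/
theorem nonempty_and_not_subset_of_cylinderProjection_ne_zero (h : IsLiFamily v e)
    {F A : Finset (ConstructibleIdeal S)} (hne : cylinderProjection e h.commute F A ≠ 0) :
    (⋂ X ∈ A, (X : Set S)).Nonempty ∧ ∀ Y ∈ F, Y ∉ A → ¬ (⋂ X ∈ A, (X : Set S)) ⊆ Y := by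
  classical
  obtain ⟨Z, hZ⟩ := exists_constructibleIdeal_eq_iInter A
  have hmul : e Z * cylinderProjection e h.commute F A = cylinderProjection e h.commute F A := by
    rw [cylinderProjection_def, h.noncommProd_eq A hZ, ← mul_assoc,
      (h.projection Z).isIdempotentElem.eq]
  rw [← hZ]
  constructor
  · rw [Set.nonempty_iff_ne_empty]
    intro h0
    have hZ0 : e Z = 0 := h.L3_empty ▸ congrArg e (Subtype.ext h0)
    rw [hZ0, zero_mul] at hmul
    exact hne hmul.symm
  · intro Y hYF hYA hsub
    have hYZ : e Z * e Y = e Z := h.mul_eq_of_coe_eq_inter (Set.inter_eq_left.2 hsub).symm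
    refine hne ?_
    rw [← hmul, ← hYZ, mul_assoc,
      mul_cylinderProjection_of_notMem h.commute hYF hYA (h.projection Y).isIdempotentElem,
      mul_zero]

end IsLiFamily

/-! ### Faithfulness on the diagonal -/

section Main

variable {S : Type u} [LeftCancelSemigroup S] {B : Type w} [CStarAlgebra B]

/-- Reduces (I) to injectivity; the target is the algebraic image of `D`, so surjectivity is
automatic. -/
theorem exists_starAlgEquiv_map_iff_injOn {A : Type*} [CStarAlgebra A] (D : StarSubalgebra ℂ A)
    (π : A →⋆ₐ[ℂ] B) :
    (∃ φ : D ≃⋆ₐ[ℂ] D.map π, ∀ d : D, (φ d : B) = π d) ↔ Set.InjOn π D := by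
  constructor
  · rintro ⟨φ, hφ⟩ x hx y hy hxy
    have : φ ⟨x, hx⟩ = φ ⟨y, hy⟩ := Subtype.ext (by rw [hφ, hφ]; exact hxy)
    exact congrArg Subtype.val (φ.injective this)
  · intro hinj
    let f : D →⋆ₐ[ℂ] D.map π := (π.comp D.subtype).codRestrict _ fun d => ⟨d, d.2, rfl⟩
    refine ⟨StarAlgEquiv.ofBijective f ⟨fun x y hxy => ?_, ?_⟩, fun d => rfl⟩
    · exact Subtype.ext (hinj x.2 y.2 (congrArg Subtype.val hxy))
    · rintro ⟨_, x, hx, rfl⟩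
      exact ⟨⟨x, hx⟩, rfl⟩

theorem imageProjection_eq_map (π : FullCStar S →⋆ₐ[ℂ] B) (F A : Finset (ConstructibleIdeal S)) :
    imageProjection π F A =
      π (cylinderProjection FullCStar.e (FullCStar.isLiFamily S).commute F A) :=
  (map_cylinderProjection (FullCStar.isLiFamily S).commute π F A).symm

theorem e_mem_diagonal (X : ConstructibleIdeal S) : FullCStar.e X ∈ diagonal S :=
  StarSubalgebra.le_topologicalClosure _ (StarAlgebra.subset_adjoin ℂ _ ⟨X, rfl⟩)

theorem cylinderProjection_mem_diagonal (F A : Finset (ConstructibleIdeal S)) :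
    cylinderProjection FullCStar.e (FullCStar.isLiFamily S).commute F A ∈ diagonal S := by
  classical
  rw [cylinderProjection_def]
  refine mul_mem (Submonoid.noncommProd_mem (diagonal S).toSubalgebra.toSubmonoid _ _ _ ?_)
    (Submonoid.noncommProd_mem (diagonal S).toSubalgebra.toSubmonoid _ _ _ ?_)
  · exact fun X _ => e_mem_diagonal X
  · exact fun Y _ => show _ ∈ diagonal S from sub_mem (one_mem _) (e_mem_diagonal Y)

theorem injOn_diagonal_of_imageProjection_ne_zero [Nonempty S] (hS : IsRightLCM S)
    (π : FullCStar S →⋆ₐ[ℂ] B)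
    (h : ∀ F : Finset (ConstructibleIdeal S), F.Nonempty →
      (∀ X ∈ F, (X : Set S) ≠ Set.univ) → imageProjection π F ∅ ≠ 0) :
    Set.InjOn π (diagonal S) := by
  have hL := FullCStar.isLiFamily S
  intro x hx y hy hxy
  have hle : ‖x - y‖ ≤ ‖π (x - y)‖ := by
    refine norm_le_norm_map_of_cylinderProjection hL.commute hL.projection
      (fun X Y => ⟨_, hL.L4 X Y⟩) ⟨_, hL.L3_whole⟩ π (fun F Z _ hne => ?_) (sub_mem hx hy)
    obtain ⟨h1, h2⟩ := hL.nonempty_and_not_subset_of_cylinderProjection_ne_zero hne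
    exact (hL.map π).cylinderProjection_ne_zero hS h h1 h2
  rw [map_sub, hxy, sub_self, norm_zero] at hle
  exact sub_eq_zero.1 (norm_le_zero_iff.1 hle)

theorem mainTheorem6 {S : Type u} [LeftCancelSemigroup S] [Nonempty S] (hS : IsRightLCM S)
    {B : Type w} [CStarAlgebra B] (π : FullCStar S →⋆ₐ[ℂ] B) :
    List.TFAE [
      ∃ φ : diagonal S ≃⋆ₐ[ℂ] (diagonal S).map π, ∀ d : diagonal S, (φ d : B) = π d,
      ∀ F A : Finset (ConstructibleIdeal S), F.Nonempty → A.Nonempty → A ⊆ F →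
        ((⋂ X ∈ A, (X : Set S)) ∩ ⋂ Y ∈ F, ⋂ _ : Y ∉ A, (Y : Set S)ᶜ).Nonempty →
        imageProjection π F A ≠ 0,
      ∀ F : Finset (ConstructibleIdeal S), F.Nonempty → (∀ X ∈ F, (X : Set S) ≠ Set.univ) →
        imageProjection π F ∅ ≠ 0] := by
  classical
  tfae_have 1 → 2 := by
    intro h F A _ _ _ hne h0
    have hinj := (exists_starAlgEquiv_map_iff_injOn (diagonal S) π).1 h
    refine FullCStar.cylinderProjection_ne_zero hne ?_
    refine hinj (cylinderProjection_mem_diagonal F A) (zero_mem _) ?_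
    rw [← imageProjection_eq_map, h0, map_zero]
  tfae_have 2 → 3 := by
    intro h F _ hF
    have hL := (FullCStar.isLiFamily S).map π
    have hS' : ConstructibleIdeal.whole S ∉ F := fun h => hF _ h rfl
    obtain ⟨s, hs⟩ := exists_forall_notMem_constructibleIdeal hS F hF
    -- Condition (II) needs `A` non-empty; `A = {S}` contributes only the factor `1`.
    have h1 := h (insert (.whole S) F) {.whole S} (Finset.insert_nonempty _ _)
      (Finset.singleton_nonempty _) (by simp) ⟨s, by
        simp only [Set.mem_inter_iff, Set.mem_iInter, Finset.mem_singleton, forall_eq,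
          Set.mem_compl_iff, Finset.mem_insert]
        refine ⟨Set.mem_univ s, ?_⟩
        rintro Y (rfl | hY) hne
        · exact absurd rfl hne
        · exact hs Y hY⟩
    have h2 : insert (ConstructibleIdeal.whole S) F \ {ConstructibleIdeal.whole S} = F := by
      rw [Finset.insert_sdiff_of_mem _ (Finset.mem_singleton_self _),
        Finset.sdiff_singleton_eq_erase, Finset.erase_eq_of_notMem hS']
    intro h0
    refine h1 ?_
    rw [imageProjection, hL.cylinderProjection_empty_right] at h0
    rw [imageProjection, cylinderProjection_def, Finset.noncommProd_congr h2 fun _ _ => rfl, h0,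
      mul_zero]
  tfae_have 3 → 1 := fun h => (exists_starAlgEquiv_map_iff_injOn (diagonal S) π).2
    (injOn_diagonal_of_imageProjection_ne_zero hS π h)
  tfae_finish

end Main
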